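/- **Proposition.** Let $h\ge 0$ (the squared absolute value of a fading channel coefficient) have a probability density function $p$ on $[0,\infty)$ with $\mathbf E_h[\log(1+h)]<\infty$, where $\mathbf E_h[f(h)]=\int_0^\infty f(h)p(h)\,dh$. Let $\sigma_N>0$ and $R>0$. For measurable power allocations $P,J:[0,\infty)\to[0,\infty)$ of the transmitter and the jammer within a frame, let $$C(P,J)=\mathbf E_h\!\left[\log\!\left(1+\frac{h\,P(h)}{\sigma_N^2+J(h)}\right)\right]\in[0,\infty]$$ be the ergodic capacity. For $J_M\ge 0$ let $$\mathscr P_M(J_M)=\max_{\substack{J\ge 0\\ \mathbf E_h[J(h)]\le J_M}}\ \ \min_{\substack{P\ge 0\\ C(P,J)\ge R}}\ \mathbf E_h[P(h)]$$ be the transmitter power required over a frame under optimal maximin intra-frame power control (the jammer plays first with power $J_M$). Then, for every $J_M\ge 0$, optimal strategies exist (that is, some admissible $J$ attains the maximum over $J$ of the infimum over $P$, and against it some $P$ attains that infimum) and $\mathscr P_M(J_M)$ is finite; and $\mathscr P_M$ is a strictly increasing, unbounded and concave function of $J_M\in[0,\infty)$. -/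

import Mathlib

open MeasureTheory
open scoped ENNReal NNReal

namespace JammingGame

/-- `p` is a probability density function on `[0, ∞)`; it is the p.d.f. of the squared absolute
value `h` of the channel coefficient. -/
structure IsChannelPDF (p : ℝ → ℝ) : Prop where
  measurable : Measurable p
  nonneg : ∀ h, 0 ≤ p h
  total : ∫⁻ h in Set.Ici (0 : ℝ), ENNReal.ofReal (p h) = 1

/-- The law of the channel coefficient: the measure with density `p` on `[0, ∞)`. -/
noncomputable def channelLaw (p : ℝ → ℝ) : Measure ℝ :=
  (volume.restrict (Set.Ici (0 : ℝ))).withDensity fun h => ENNReal.ofReal (p h)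

/-- The power `E_h[Q(h)]` that a power control strategy `Q ≥ 0` spends over a frame. -/
noncomputable def meanPower (p : ℝ → ℝ) (Q : ℝ → ℝ≥0) : ℝ≥0∞ :=
  ∫⁻ h, (Q h : ℝ≥0∞) ∂channelLaw p

/-- The ergodic capacity `C(P, J) = E_h[log (1 + h P(h) / (σ² + J(h)))]` over a frame.
The integrand is nonnegative on `[0, ∞)`, so the expectation is taken in `[0, ∞]`. -/
noncomputable def ergodicCapacity (p : ℝ → ℝ) (σ : ℝ) (P J : ℝ → ℝ≥0) : ℝ≥0∞ :=
  ∫⁻ h, ENNReal.ofReal (Real.log (1 + h * (P h : ℝ) / (σ ^ 2 + (J h : ℝ)))) ∂channelLaw p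

/-- The jammer's strategies within a frame under the power constraint `E_h[J(h)] ≤ j`. -/
def jammerStrategies (p : ℝ → ℝ) (j : ℝ) : Set (ℝ → ℝ≥0) :=
  {J | Measurable J ∧ meanPower p J ≤ ENNReal.ofReal j}

/-- The transmitter's strategies that achieve reliable communication at rate `R` against `J`. -/
def reliableStrategies (p : ℝ → ℝ) (σ R : ℝ) (J : ℝ → ℝ≥0) : Set (ℝ → ℝ≥0) :=
  {P | Measurable P ∧ ENNReal.ofReal R ≤ ergodicCapacity p σ P J}

/-- The least power with which the transmitter communicates reliably against `J`. -/
noncomputable def minTxPower (p : ℝ → ℝ) (σ R : ℝ) (J : ℝ → ℝ≥0) : ℝ≥0∞ :=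
  ⨅ P ∈ reliableStrategies p σ R J, meanPower p P

/-- The required transmitter power over a frame in which the jammer, playing first, invests the
power `j`: the value of the maximin intra-frame power control problem. -/
noncomputable def requiredTxPower (p : ℝ → ℝ) (σ R j : ℝ) : ℝ≥0∞ :=
  ⨆ J ∈ jammerStrategies p j, minTxPower p σ R J

/-- `(J, P)` are optimal maximin intra-frame power control strategies for jammer power `j`:
`P` attains the inner minimum against `J`, and `J` attains the outer maximum. -/
structure IsMaximinOptimal (p : ℝ → ℝ) (σ R j : ℝ) (J P : ℝ → ℝ≥0) : Prop where
  jammer_mem : J ∈ jammerStrategies p j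
  tx_mem : P ∈ reliableStrategies p σ R J
  tx_optimal : meanPower p P = minTxPower p σ R J
  jammer_optimal : minTxPower p σ R J = requiredTxPower p σ R j

end JammingGame

/-!
Write `s = σ²` and parametrize the transmitter's strategies by the ratio `φ = P / (s + J)`. The
rate `E[log (1 + hφ)]` then depends on `φ` alone, while the power `E[φ (s + J)]` is affine in `J`.
Three things follow from this change of variables (`transfer`).

* The least power against `J` is an infimum of affine functions of `J`, hence concave
  (`minTxPower_concave`). As optimal jammers exist and the jammer's budget is affine too, the value
  is concave in the budget.
* Against the uniform jammer `J = j` all powers are `1 + j / s` times those against `J = 0`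
  (`mul_minTxPower_le_requiredTxPower`). The least power against `0` is attained and the rate is
  positive, so it is not zero and the value is unbounded. A monotone, concave, unbounded function is
  strictly monotone.
* For a fixed `φ` bounded by `ν`, no jammer with budget `j` forces a power above `s E[φ] + ν j`, and
  a jammer that spends `j` only where `φ = ν` does force it (`meanPower_transfer_le`).

It remains to exhibit a saddle point. Against a given `J` the transmitter's best reply is
water-filling, `P = (w - (s + J) / h)⁺`, because it minimizes power minus `w` times rate for every
`h` separately (`lagrangian_le`). Combined with the last item above this forces, with `w = aν`,
`J = (a νh / (1 + νh) - s)⁺` and `1 + hφ = max 1 (min (aνh / s) (1 + νh))`. The two parameters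
`ν > 0` and `a ≥ s` are determined by `E[J] = j` and by the rate being `R` (`exists_parameters`).
For fixed `ν` the first equation is solved in `a`; its solution is continuous in `ν` because `E[J]`
is convex in `a`. Along this curve the rate tends to `0` as `ν → 0`, where integrability of
`log (1 + h)` enters through dominated convergence, and is unbounded as `ν → ∞`, so the
intermediate value theorem solves the second equation. Since `P ≤ aν`, the value is finite.
-/

namespace JammingGame

/-! ### The channel law -/

theorem channelLaw_isProbabilityMeasure {p : ℝ → ℝ} (hp : IsChannelPDF p) :
    IsProbabilityMeasure (channelLaw p) :=
  ⟨by rw [channelLaw, withDensity_apply _ MeasurableSet.univ, Measure.restrict_univ, hp.total]⟩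

/-- The coefficient has a density, so the value `0`, at which the channel carries nothing, is
negligible. -/
theorem ae_pos_channelLaw (p : ℝ → ℝ) : ∀ᵐ h ∂channelLaw p, 0 < h := by
  have h0 : ∀ᵐ h ∂(volume.restrict (Set.Ici (0 : ℝ))), 0 < h := by
    rw [← restrict_Ioi_eq_restrict_Ici]
    exact ae_restrict_mem measurableSet_Ioi
  exact (withDensity_absolutelyContinuous _ _).ae_le h0

/-! ### Solving for the two parameters of the saddle point -/

section Parameters

variable {μ : Measure ℝ}

theorem integrable_log_one_add_mul [IsFiniteMeasure μ] (hpos : ∀ᵐ h ∂μ, 0 < h)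
    (hlog : Integrable (fun h : ℝ => Real.log (1 + h)) μ) {c : ℝ} (hc : 0 ≤ c) :
    Integrable (fun h : ℝ => Real.log (1 + c * h)) μ := by
  refine ((integrable_const (Real.log (1 + c))).add hlog).mono' (Measurable.aestronglyMeasurable (by fun_prop)) ?_
  filter_upwards [hpos] with h hh
  have h1 : 0 ≤ c * h := by positivity
  rw [Real.norm_of_nonneg (Real.log_nonneg (by linarith)), Pi.add_apply,
    ← Real.log_mul (by positivity) (by positivity)]
  exact Real.log_le_log (by positivity) (by nlinarith)

/-- Mean power of the jamming profile `(a νh/(1+νh) - s)⁺`. -/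
noncomputable def jamMean (μ : Measure ℝ) (s ν a : ℝ) : ℝ :=
  ∫ h, max (a * (ν * h / (1 + ν * h)) - s) 0 ∂μ

/-- Mean rate at which water-filling at level `aν` transmits against the jamming profile
`(a νh/(1+νh) - s)⁺` on top of the noise `s`. -/
noncomputable def rateMean (μ : Measure ℝ) (s ν a : ℝ) : ℝ :=
  ∫ h, Real.log (max 1 (min (a * ν * h / s) (1 + ν * h))) ∂μ

theorem mul_div_one_add_mul_mem_Ioo {ν h : ℝ} (hν : 0 < ν) (hh : 0 < h) :
    0 < ν * h / (1 + ν * h) ∧ ν * h / (1 + ν * h) < 1 := by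
  have : 0 < ν * h := by positivity
  exact ⟨by positivity, by rw [div_lt_one (by positivity)]; linarith⟩

theorem jam_le {s ν a h : ℝ} (hs : 0 < s) (hν : 0 < ν) (hh : 0 < h) :
    ‖max (a * (ν * h / (1 + ν * h)) - s) 0‖ ≤ |a| := by
  obtain ⟨h0, h1⟩ := mul_div_one_add_mul_mem_Ioo hν hh
  rw [Real.norm_of_nonneg (le_max_right _ _)]
  refine max_le ?_ (abs_nonneg a)
  nlinarith [le_abs_self a, abs_nonneg a]

theorem integrable_jam [IsFiniteMeasure μ] (hpos : ∀ᵐ h ∂μ, 0 < h) {s ν : ℝ} (a : ℝ)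
    (hs : 0 < s) (hν : 0 < ν) :
    Integrable (fun h : ℝ => max (a * (ν * h / (1 + ν * h)) - s) 0) μ := by
  refine (integrable_const |a|).mono' (Measurable.aestronglyMeasurable (by fun_prop)) ?_
  filter_upwards [hpos] with h hh using jam_le hs hν hh

theorem jamMean_mono [IsFiniteMeasure μ] (hpos : ∀ᵐ h ∂μ, 0 < h) {s ν : ℝ}
    (hs : 0 < s) (hν : 0 < ν) : Monotone (jamMean μ s ν) := by
  intro a b hab
  refine integral_mono_ae (integrable_jam hpos a hs hν) (integrable_jam hpos b hs hν) ?_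
  filter_upwards [hpos] with h hh
  obtain ⟨h0, -⟩ := mul_div_one_add_mul_mem_Ioo hν hh
  gcongr

theorem jamMean_self (hpos : ∀ᵐ h ∂μ, 0 < h) {s ν : ℝ} (hs : 0 < s) (hν : 0 < ν) :
    jamMean μ s ν s = 0 := by
  refine integral_eq_zero_of_ae ?_
  filter_upwards [hpos] with h hh
  obtain ⟨-, h1⟩ := mul_div_one_add_mul_mem_Ioo hν hh
  exact max_eq_right (by nlinarith)

/-- Convexity of the mean jamming power in the level `a`, which vanishes at `a = s`. -/
theorem jamMean_convex [IsFiniteMeasure μ] (hpos : ∀ᵐ h ∂μ, 0 < h) {s ν a b : ℝ}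
    (hs : 0 < s) (hν : 0 < ν) (ha : s ≤ a) (hab : a ≤ b) :
    (b - s) * jamMean μ s ν a ≤ (a - s) * jamMean μ s ν b := by
  unfold jamMean
  rw [← integral_const_mul, ← integral_const_mul]
  refine integral_mono_ae ((integrable_jam hpos a hs hν).const_mul _)
    ((integrable_jam hpos b hs hν).const_mul _) ?_
  filter_upwards [hpos] with h hh
  obtain ⟨h0, h1⟩ := mul_div_one_add_mul_mem_Ioo hν hh
  generalize ν * h / (1 + ν * h) = u at h0 h1
  rcases le_total (a * u - s) 0 with h2 | h2
  · rw [max_eq_right h2, mul_zero]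
    exact mul_nonneg (by linarith) (le_max_right _ _)
  · rw [max_eq_left h2, max_eq_left (by nlinarith)]
    nlinarith [mul_nonneg (mul_nonneg hs.le (sub_nonneg.2 hab)) (sub_nonneg.2 h1.le)]

theorem jamMean_continuousAt_param [IsFiniteMeasure μ] (hpos : ∀ᵐ h ∂μ, 0 < h) {s ν a : ℝ}
    (hs : 0 < s) (hν : 0 < ν) : ContinuousAt (fun x => jamMean μ s x a) ν := by
  refine continuousAt_of_dominated (bound := fun _ => |a|)
    (.of_forall fun x => Measurable.aestronglyMeasurable (by fun_prop)) ?_ (integrable_const _) ?_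
  · filter_upwards [lt_mem_nhds hν] with x hx
    filter_upwards [hpos] with h hh using jam_le hs hx hh
  · filter_upwards [hpos] with h hh
    have : 1 + ν * h ≠ 0 := by positivity
    fun_prop (disch := assumption)

theorem jamMean_continuous_level [IsFiniteMeasure μ] (hpos : ∀ᵐ h ∂μ, 0 < h) {s ν : ℝ}
    (hs : 0 < s) (hν : 0 < ν) : Continuous (jamMean μ s ν) := by
  refine continuous_iff_continuousAt.2 fun a => ?_
  refine continuousAt_of_dominated (bound := fun _ => |a| + 1)
    (.of_forall fun x => Measurable.aestronglyMeasurable (by fun_prop)) ?_ (integrable_const _) ?_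
  · filter_upwards [(continuous_abs.tendsto a).eventually (gt_mem_nhds (lt_add_one |a|))] with x hx
    filter_upwards [hpos] with h hh using (jam_le hs hν hh).trans hx.le
  · exact .of_forall fun h => by fun_prop

/-- For every `ν > 0` some level `a ≥ s` makes the jammer spend exactly `j`. -/
theorem exists_jamMean_eq [IsProbabilityMeasure μ] (hpos : ∀ᵐ h ∂μ, 0 < h) {s ν j : ℝ}
    (hs : 0 < s) (hν : 0 < ν) (hj : 0 ≤ j) : ∃ a, s ≤ a ∧ jamMean μ s ν a = j := by
  have hint : Integrable (fun h : ℝ => ν * h / (1 + ν * h)) μ := by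
    refine (integrable_const (1 : ℝ)).mono' (Measurable.aestronglyMeasurable (by fun_prop)) ?_
    filter_upwards [hpos] with h hh
    obtain ⟨h0, h1⟩ := mul_div_one_add_mul_mem_Ioo hν hh
    rw [Real.norm_of_nonneg h0.le]
    exact h1.le
  have hE : 0 < ∫ h, ν * h / (1 + ν * h) ∂μ := by
    rw [integral_pos_iff_support_of_nonneg_ae _ hint]
    · have : (Function.support fun h : ℝ => ν * h / (1 + ν * h)) =ᵐ[μ] Set.univ := by
        filter_upwards [hpos] with h hh
        exact eq_true (mul_div_one_add_mul_mem_Ioo hν hh).1.ne'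
      rw [measure_congr this]
      simp
    · filter_upwards [hpos] with h hh using (mul_div_one_add_mul_mem_Ioo hν hh).1.le
  set e := ∫ h, ν * h / (1 + ν * h) ∂μ with he
  have hlow : ∀ a, a * e - s ≤ jamMean μ s ν a := fun a => by
    have : a * e - s = ∫ h, (a * (ν * h / (1 + ν * h)) - s) ∂μ := by
      rw [integral_sub (hint.const_mul a) (integrable_const s), integral_const_mul]
      simp [he]
    rw [this]
    exact integral_mono ((hint.const_mul a).sub (integrable_const s))
      (integrable_jam hpos a hs hν) fun h => le_max_left _ _
  have hb : j ≤ jamMean μ s ν (max s ((s + j) / e)) := by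
    refine le_trans ?_ (hlow _)
    have : (s + j) / e * e ≤ max s ((s + j) / e) * e := by
      gcongr
      exact le_max_right _ _
    rw [div_mul_cancel₀ _ hE.ne'] at this
    linarith
  obtain ⟨a, ha, hae⟩ := intermediate_value_Icc (le_max_left s ((s + j) / e))
    (jamMean_continuous_level hpos hs hν).continuousOn
    ⟨(jamMean_self hpos hs hν).trans_le hj, hb⟩
  exact ⟨a, ha.1, hae⟩

/-- The level at which the jammer spends exactly `j` can be chosen continuously in `ν`: for `j > 0`
convexity makes the mean jamming power cross the value `j` strictly; for `j = 0` the level `s`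
does. -/
theorem exists_continuous_level [IsProbabilityMeasure μ] (hpos : ∀ᵐ h ∂μ, 0 < h) {s j : ℝ}
    (hs : 0 < s) (hj : 0 ≤ j) : ∃ a : ℝ → ℝ, ContinuousOn a (Set.Ioi 0) ∧
      ∀ ν, 0 < ν → s ≤ a ν ∧ jamMean μ s ν (a ν) = j := by
  rcases hj.eq_or_lt with rfl | hj'
  · exact ⟨fun _ => s, continuousOn_const, fun ν hν => ⟨le_rfl, jamMean_self hpos hs hν⟩⟩
  choose! a ha using fun ν (hν : 0 < ν) => exists_jamMean_eq hpos hs hν hj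
  refine ⟨a, fun ν hν => ContinuousAt.continuousWithinAt ?_, ha⟩
  have hν' : 0 < ν := hν
  obtain ⟨h1, h2⟩ := ha ν hν
  have h3 : s < a ν := h1.lt_of_ne fun h => by
    rw [← h, jamMean_self hpos hs hν] at h2
    exact hj'.ne h2
  refine tendsto_order.2 ⟨fun b hb => ?_, fun b hb => ?_⟩
  · have hlt : jamMean μ s ν b < j := by
      rcases le_total s b with hsb | hsb
      · have := jamMean_convex hpos hs hν hsb hb.le
        rw [h2] at this
        nlinarith
      · exact ((jamMean_mono hpos hs hν hsb).trans_eq (jamMean_self hpos hs hν)).trans_lt hj'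
    filter_upwards [(jamMean_continuousAt_param hpos hs hν).eventually (gt_mem_nhds hlt),
      lt_mem_nhds hν'] with x hx hx0
    by_contra! hcon
    exact absurd (jamMean_mono hpos hs hx0 hcon) (by rw [(ha x hx0).2]; exact not_le.2 hx)
  · have hlt : j < jamMean μ s ν b := by
      have := jamMean_convex hpos hs hν h1 hb.le
      rw [h2] at this
      nlinarith
    filter_upwards [(jamMean_continuousAt_param hpos hs hν).eventually (lt_mem_nhds hlt),
      lt_mem_nhds hν'] with x hx hx0
    by_contra! hcon
    exact absurd (jamMean_mono hpos hs hx0 hcon) (by rw [(ha x hx0).2]; exact not_le.2 hx)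

theorem norm_rate_le {s ν a h : ℝ} (hν : 0 ≤ ν) (hh : 0 < h) :
    ‖Real.log (max 1 (min (a * ν * h / s) (1 + ν * h)))‖ ≤ Real.log (1 + ν * h) := by
  have : 0 ≤ ν * h := by positivity
  rw [Real.norm_of_nonneg (Real.log_nonneg (le_max_left _ _))]
  exact Real.log_le_log (by positivity) (max_le (by linarith) (min_le_right _ _))

theorem integrable_rate [IsFiniteMeasure μ] (hpos : ∀ᵐ h ∂μ, 0 < h)
    (hlog : Integrable (fun h : ℝ => Real.log (1 + h)) μ) {s ν : ℝ} (a : ℝ) (hν : 0 ≤ ν) :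
    Integrable (fun h : ℝ => Real.log (max 1 (min (a * ν * h / s) (1 + ν * h)))) μ := by
  refine (integrable_log_one_add_mul hpos hlog hν).mono' (Measurable.aestronglyMeasurable (by fun_prop)) ?_
  filter_upwards [hpos] with h hh using norm_rate_le hν hh

theorem rateMean_continuousOn [IsFiniteMeasure μ] (hpos : ∀ᵐ h ∂μ, 0 < h)
    (hlog : Integrable (fun h : ℝ => Real.log (1 + h)) μ) {s : ℝ} {a : ℝ → ℝ}
    (ha : ContinuousOn a (Set.Ioi 0)) :
    ContinuousOn (fun ν => rateMean μ s ν (a ν)) (Set.Ioi 0) := by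
  intro ν hν
  have hν' : 0 < ν := hν
  have hca : ContinuousAt a ν := ha.continuousAt (Ioi_mem_nhds hν)
  refine ContinuousAt.continuousWithinAt ?_
  refine continuousAt_of_dominated (bound := fun h => Real.log (1 + (ν + 1) * h))
    (.of_forall fun x => Measurable.aestronglyMeasurable (by fun_prop)) ?_
    (integrable_log_one_add_mul hpos hlog (by positivity)) ?_
  · filter_upwards [lt_mem_nhds hν', gt_mem_nhds (lt_add_one ν)] with x hx0 hx1
    filter_upwards [hpos] with h hh
    refine (norm_rate_le hx0.le hh).trans (Real.log_le_log (by positivity) ?_)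
    gcongr
  · refine .of_forall fun h => ContinuousAt.log ?_ (by positivity)
    fun_prop

/-- Letting the transmitter's relative power `ν` shrink drives the rate to `0`. -/
theorem exists_rateMean_le [IsFiniteMeasure μ] (hpos : ∀ᵐ h ∂μ, 0 < h)
    (hlog : Integrable (fun h : ℝ => Real.log (1 + h)) μ) {R : ℝ} (hR : 0 < R) (s : ℝ)
    (a : ℝ → ℝ) : ∃ ν, 0 < ν ∧ rateMean μ s ν (a ν) ≤ R := by
  have hlim : Filter.Tendsto (fun ν : ℝ => ∫ h, Real.log (1 + ν * h) ∂μ)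
      (nhdsWithin 0 (Set.Ioi 0)) (nhds (∫ h, Real.log (1 + 0 * h) ∂μ)) := by
    refine tendsto_integral_filter_of_dominated_convergence (fun h => Real.log (1 + h))
      (.of_forall fun x => Measurable.aestronglyMeasurable (by fun_prop)) ?_ hlog ?_
    · filter_upwards [self_mem_nhdsWithin, mem_nhdsWithin_of_mem_nhds (gt_mem_nhds one_pos)]
        with x hx0 hx1
      have hx0' : 0 < x := hx0
      filter_upwards [hpos] with h hh
      have : 0 < x * h := by positivity
      rw [Real.norm_of_nonneg (Real.log_nonneg (by linarith))]
      exact Real.log_le_log (by positivity) (by nlinarith)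
    · refine .of_forall fun h => Filter.Tendsto.mono_left ?_ nhdsWithin_le_nhds
      have : ContinuousAt (fun ν : ℝ => Real.log (1 + ν * h)) 0 :=
        ContinuousAt.log (by fun_prop) (by simp)
      exact this
  simp only [zero_mul, add_zero, Real.log_one, integral_zero] at hlim
  obtain ⟨ν, hν, hν0⟩ := ((hlim.eventually (gt_mem_nhds hR)).and self_mem_nhdsWithin).exists
  refine ⟨ν, hν0, le_trans ?_ hν.le⟩
  have hν0' : 0 < ν := hν0
  refine integral_mono_ae (integrable_rate hpos hlog _ hν0'.le)
    (integrable_log_one_add_mul hpos hlog hν0'.le) ?_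
  filter_upwards [hpos] with h hh using (le_abs_self _).trans (norm_rate_le hν0'.le hh)

/-- A large relative power `ν` drives the rate above `R`, whatever levels `a ν ≥ s` the jammer
uses. -/
theorem exists_le_rateMean [IsProbabilityMeasure μ] (hpos : ∀ᵐ h ∂μ, 0 < h)
    (hlog : Integrable (fun h : ℝ => Real.log (1 + h)) μ) {R s : ℝ} (hs : 0 < s)
    {a : ℝ → ℝ} (ha : ∀ ν, 0 < ν → s ≤ a ν) : ∃ ν, 0 < ν ∧ R ≤ rateMean μ s ν (a ν) := by
  obtain ⟨n, hn⟩ : ∃ n : ℕ, μ (Set.Ioi (1 / ((n : ℝ) + 1))) ≠ 0 := by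
    by_contra! hcon
    have hU : (⋃ n : ℕ, Set.Ioi (1 / ((n : ℝ) + 1))) =ᵐ[μ] Set.univ := by
      filter_upwards [hpos] with h hh
      obtain ⟨n, hn⟩ := exists_nat_one_div_lt hh
      exact eq_true (Set.mem_iUnion.2 ⟨n, hn⟩)
    have := measure_congr hU
    rw [measure_iUnion_null hcon, measure_univ] at this
    exact zero_ne_one this
  set c : ℝ := 1 / ((n : ℝ) + 1) with hc
  have hc0 : 0 < c := by positivity
  set m : ℝ := μ.real (Set.Ioi c) with hm
  have hm0 : 0 < m := ENNReal.toReal_pos hn (measure_ne_top _ _)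
  -- At this `ν` the coefficients `h > c`, of probability `m`, alone contribute the rate `R`.
  refine ⟨Real.exp (R / m) / c, by positivity, ?_⟩
  set ν := Real.exp (R / m) / c with hν
  have hν0 : 0 < ν := by positivity
  have hR : R = ∫ h, (Set.Ioi c).indicator (fun _ => R / m) h ∂μ := by
    rw [integral_indicator_const _ measurableSet_Ioi, smul_eq_mul, ← hm, mul_div_cancel₀ _ hm0.ne']
  rw [hR]
  refine integral_mono ((integrable_const _).indicator measurableSet_Ioi)
    (integrable_rate hpos hlog _ hν0.le) fun h => ?_
  by_cases hh : h ∈ Set.Ioi c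
  · have hh' : c < h := hh
    have hh0 : 0 < h := hc0.trans hh'
    rw [Set.indicator_of_mem hh]
    refine (Real.le_log_iff_exp_le (by positivity)).2 (le_trans ?_ (le_max_right _ _))
    have h1 : Real.exp (R / m) ≤ ν * h := by
      rw [hν, div_mul_eq_mul_div, le_div_iff₀ hc0]
      gcongr
    refine h1.trans (le_min ?_ (by linarith))
    rw [le_div_iff₀ hs]
    nlinarith [mul_le_mul_of_nonneg_right (ha ν hν0) (mul_pos hν0 hh0).le]
  · rw [Set.indicator_of_notMem hh]
    exact Real.log_nonneg (le_max_left _ _)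

/-- The jammer's budget `j` and the rate `R` can be met simultaneously. -/
theorem exists_parameters [IsProbabilityMeasure μ] (hpos : ∀ᵐ h ∂μ, 0 < h)
    (hlog : Integrable (fun h : ℝ => Real.log (1 + h)) μ) {s R j : ℝ} (hs : 0 < s) (hR : 0 < R)
    (hj : 0 ≤ j) :
    ∃ ν a, 0 < ν ∧ s ≤ a ∧ jamMean μ s ν a = j ∧ rateMean μ s ν a = R := by
  obtain ⟨a, hca, ha⟩ := exists_continuous_level hpos hs hj
  obtain ⟨x, hx0, hx⟩ := exists_rateMean_le hpos hlog hR s a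
  obtain ⟨y, hy0, hy⟩ := exists_le_rateMean (R := R) hpos hlog hs fun ν hν => (ha ν hν).1
  obtain ⟨ν, hν, hνR⟩ := isPreconnected_Ioi.intermediate_value hx0 hy0
    (rateMean_continuousOn (s := s) hpos hlog hca) ⟨hx, hy⟩
  exact ⟨ν, a ν, hν, (ha ν hν).1, (ha ν hν).2, hνR⟩

end Parameters

/-! ### Rescaling a strategy to another jammer -/

/-- The transmitter strategy which has, against the jammer `J'`, the same signal-to-noise ratio as
`P` has against `J`. -/
noncomputable def transfer (σ : ℝ) (P J J' : ℝ → ℝ≥0) (h : ℝ) : ℝ≥0 :=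
  P h * ((σ ^ 2).toNNReal + J' h) / ((σ ^ 2).toNNReal + J h)

theorem coe_transfer (σ : ℝ) (P J J' : ℝ → ℝ≥0) (h : ℝ) :
    (transfer σ P J J' h : ℝ) = P h * (σ ^ 2 + J' h) / (σ ^ 2 + J h) := by
  simp [transfer, Real.coe_toNNReal _ (sq_nonneg σ)]

theorem measurable_transfer (σ : ℝ) {P J J' : ℝ → ℝ≥0} (hP : Measurable P) (hJ : Measurable J)
    (hJ' : Measurable J') : Measurable (transfer σ P J J') := by
  unfold transfer
  fun_prop

theorem ergodicCapacity_transfer (p : ℝ → ℝ) {σ : ℝ} (hσ : 0 < σ) (P J J' : ℝ → ℝ≥0) :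
    ergodicCapacity p σ (transfer σ P J J') J' = ergodicCapacity p σ P J := by
  unfold ergodicCapacity
  congr 1 with h
  rw [coe_transfer]
  have h1 : σ ^ 2 + (J' h : ℝ) ≠ 0 := by positivity
  have h2 : σ ^ 2 + (J h : ℝ) ≠ 0 := by positivity
  congr 3
  field_simp

theorem transfer_mem {p : ℝ → ℝ} {σ R : ℝ} (hσ : 0 < σ) {P J J' : ℝ → ℝ≥0}
    (hJ : Measurable J) (hJ' : Measurable J') (hP : P ∈ reliableStrategies p σ R J) :
    transfer σ P J J' ∈ reliableStrategies p σ R J' :=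
  ⟨measurable_transfer σ hP.1 hJ hJ', (ergodicCapacity_transfer p hσ P J J').symm ▸ hP.2⟩

theorem minTxPower_le {p : ℝ → ℝ} {σ R : ℝ} {P J : ℝ → ℝ≥0}
    (hP : P ∈ reliableStrategies p σ R J) : minTxPower p σ R J ≤ meanPower p P :=
  iInf₂_le P hP

theorem minTxPower_le_requiredTxPower {p : ℝ → ℝ} {σ R j : ℝ} {J : ℝ → ℝ≥0}
    (hJ : J ∈ jammerStrategies p j) : minTxPower p σ R J ≤ requiredTxPower p σ R j :=
  le_iSup₂ (f := fun J (_ : J ∈ jammerStrategies p j) => minTxPower p σ R J) J hJ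

/-- For a fixed signal-to-noise ratio the transmitter's power is affine in the jammer's, so the
least power, an infimum of affine functions, is concave in the jammer's strategy. -/
theorem minTxPower_concave {p : ℝ → ℝ} {σ R : ℝ} (hσ : 0 < σ) {J₁ J₂ : ℝ → ℝ≥0}
    (h₁ : Measurable J₁) (h₂ : Measurable J₂) {x y : ℝ≥0} (hxy : x + y = 1) :
    x * minTxPower p σ R J₁ + y * minTxPower p σ R J₂ ≤
      minTxPower p σ R (fun h => x * J₁ h + y * J₂ h) := by
  have hm : Measurable fun h => x * J₁ h + y * J₂ h := by fun_prop
  refine le_iInf₂ fun P hP => ?_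
  have e₁ := minTxPower_le (transfer_mem hσ hm h₁ hP)
  have e₂ := minTxPower_le (transfer_mem hσ hm h₂ hP)
  refine (add_le_add (mul_le_mul_right e₁ _) (mul_le_mul_right e₂ _)).trans_eq ?_
  have m₁ := measurable_transfer σ hP.1 hm h₁
  have m₂ := measurable_transfer σ hP.1 hm h₂
  unfold meanPower
  rw [← lintegral_const_mul _ (by fun_prop), ← lintegral_const_mul _ (by fun_prop),
    ← lintegral_add_left (by fun_prop)]
  refine lintegral_congr fun h => ?_
  norm_cast
  refine NNReal.eq ?_
  push_cast
  rw [coe_transfer, coe_transfer]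
  push_cast
  have hxy' : (y : ℝ) = 1 - x := by
    rw [eq_sub_iff_add_eq, add_comm]
    exact_mod_cast hxy
  have h3 : σ ^ 2 + ((x : ℝ) * J₁ h + y * J₂ h) ≠ 0 := by positivity
  field_simp
  rw [hxy']
  ring

/-! ### Water-filling -/

/-- Water-filling at level `w` over the noise `σ² + J` divided by the gain `h`. -/
noncomputable def waterFilling (σ w : ℝ) (J : ℝ → ℝ≥0) (h : ℝ) : ℝ≥0 :=
  (w - (σ ^ 2 + J h) / h).toNNReal

theorem measurable_waterFilling (σ w : ℝ) {J : ℝ → ℝ≥0} (hJ : Measurable J) :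
    Measurable (waterFilling σ w J) := by
  unfold waterFilling
  fun_prop

/-- For a fixed gain `h` over the noise `N`, water-filling at level `w` minimizes power minus `w`
times rate. -/
theorem lagrangian_le {h N w P : ℝ} (hh : 0 < h) (hN : 0 < N) (hw : 0 ≤ w) (hP : 0 ≤ P) :
    max (w - N / h) 0 + w * Real.log (1 + h * P / N) ≤
      P + w * Real.log (1 + h * max (w - N / h) 0 / N) := by
  have hx : 0 < 1 + h * P / N := by positivity
  rcases le_total (w - N / h) 0 with h1 | h1
  · rw [max_eq_right h1]
    have h2 : w * h ≤ N := by rw [sub_nonpos, le_div_iff₀ hh] at h1; exact h1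
    have h3 : w * Real.log (1 + h * P / N) ≤ w * (h * P / N) :=
      mul_le_mul_of_nonneg_left (by linarith [Real.log_le_sub_one_of_pos hx]) hw
    have h4 : w * (h * P / N) ≤ P := by
      rw [← mul_div_assoc, div_le_iff₀ hN]
      nlinarith
    simp
    linarith
  · rw [max_eq_left h1]
    have h2 : N ≤ w * h := by rw [sub_nonneg, div_le_iff₀ hh] at h1; exact h1
    have hw' : 0 < w := pos_of_mul_pos_left (hN.trans_le h2) hh.le
    have h3 : 1 + h * (w - N / h) / N = w * h / N := by field_simp; ring
    have h4 : Real.log (1 + h * P / N) - Real.log (w * h / N) ≤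
        (1 + h * P / N) / (w * h / N) - 1 := by
      rw [← Real.log_div hx.ne' (by positivity)]
      exact Real.log_le_sub_one_of_pos (by positivity)
    have h5 : w * ((1 + h * P / N) / (w * h / N) - 1) = P - (w - N / h) := by field_simp; ring
    rw [h3]
    nlinarith [mul_le_mul_of_nonneg_left h4 hw]

/-- If water-filling achieves exactly the rate `R`, it does so with the least power. -/
theorem meanPower_waterFilling_le {p : ℝ → ℝ} {σ R w : ℝ} (hσ : 0 < σ) (hw : 0 ≤ w)
    {J : ℝ → ℝ≥0} (hJ : Measurable J)
    (hC : ergodicCapacity p σ (waterFilling σ w J) J = ENNReal.ofReal R)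
    {P : ℝ → ℝ≥0} (hP : P ∈ reliableStrategies p σ R J) :
    meanPower p (waterFilling σ w J) ≤ meanPower p P := by
  have hPm := hP.1
  have hWm := measurable_waterFilling σ w hJ
  have key : meanPower p (waterFilling σ w J) + ENNReal.ofReal w * ergodicCapacity p σ P J ≤
      meanPower p P + ENNReal.ofReal w * ergodicCapacity p σ (waterFilling σ w J) J := by
    unfold meanPower ergodicCapacity
    rw [← lintegral_const_mul _ (by fun_prop), ← lintegral_const_mul _ (by fun_prop),
      ← lintegral_add_left (by fun_prop), ← lintegral_add_left (by fun_prop)]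
    refine lintegral_mono_ae ?_
    filter_upwards [ae_pos_channelLaw p] with h hh
    have hl : ∀ Q : ℝ≥0, 0 ≤ Real.log (1 + h * (Q : ℝ) / (σ ^ 2 + (J h : ℝ))) := fun Q =>
      Real.log_nonneg (le_add_of_nonneg_right (by positivity))
    rw [← ENNReal.ofReal_mul hw, ← ENNReal.ofReal_mul hw, ← ENNReal.ofReal_coe_nnreal,
      ← ENNReal.ofReal_coe_nnreal, ← ENNReal.ofReal_add (by positivity) (mul_nonneg hw (hl _)),
      ← ENNReal.ofReal_add (by positivity) (mul_nonneg hw (hl _))]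
    exact ENNReal.ofReal_le_ofReal
      (lagrangian_le hh (by positivity) hw (P h).coe_nonneg)
  rw [hC] at key
  refine (ENNReal.add_le_add_iff_right (a := ENNReal.ofReal w * ENNReal.ofReal R)
    (by finiteness)).1 (le_trans ?_ key)
  gcongr
  exact hP.2

/-! ### The saddle point -/

/-- The jammer's strategy at the saddle point: the noise is raised to the level
`a νh / (1 + νh)` wherever it lies below. -/
noncomputable def jamming (σ ν a h : ℝ) : ℝ≥0 :=
  (a * (ν * h / (1 + ν * h)) - σ ^ 2).toNNReal

theorem measurable_jamming (σ ν a : ℝ) : Measurable (jamming σ ν a) := by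
  unfold jamming
  fun_prop

/-- Where the jammer is active, water-filling at level `aν` uses exactly `ν` times the total noise;
elsewhere it uses at most that. -/
theorem waterFilling_jamming {σ ν a h : ℝ} (hσ : 0 < σ) (hν : 0 < ν) (hh : 0 < h) (ha : 0 < a) :
    ((waterFilling σ (a * ν) (jamming σ ν a) h : ℝ) ≤ ν * (σ ^ 2 + jamming σ ν a h)) ∧
    (jamming σ ν a h = 0 ∨
      (waterFilling σ (a * ν) (jamming σ ν a) h : ℝ) = ν * (σ ^ 2 + jamming σ ν a h)) ∧
    1 + h * (waterFilling σ (a * ν) (jamming σ ν a) h : ℝ) / (σ ^ 2 + jamming σ ν a h) =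
      max 1 (min (a * ν * h / σ ^ 2) (1 + ν * h)) := by
  have ht : 0 < 1 + ν * h := by positivity
  have hs : 0 < σ ^ 2 := by positivity
  rcases le_total (a * (ν * h / (1 + ν * h)) - σ ^ 2) 0 with h1 | h1
  · have hJ : jamming σ ν a h = 0 := Real.toNNReal_of_nonpos h1
    have h2 : a * ν * h ≤ σ ^ 2 * (1 + ν * h) := by
      rw [sub_nonpos, ← mul_div_assoc, div_le_iff₀ ht] at h1
      linarith
    have h3 : a * ν * h / σ ^ 2 ≤ 1 + ν * h := by
      rw [div_le_iff₀ hs]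
      linarith
    rw [min_eq_left h3, waterFilling, hJ, Real.coe_toNNReal', NNReal.coe_zero, add_zero]
    refine ⟨max_le ?_ (by positivity), Or.inl rfl, ?_⟩
    · rw [sub_le_iff_le_add, ← sub_le_iff_le_add', le_div_iff₀ hh]
      linarith
    · rcases le_total (a * ν - σ ^ 2 / h) 0 with h4 | h4
      · rw [max_eq_right h4, max_eq_left]
        · simp
        · rw [sub_nonpos, le_div_iff₀ hh] at h4
          exact (div_le_one hs).2 h4
      · rw [max_eq_left h4, max_eq_right]
        · field_simp
          ring
        · rw [sub_nonneg, div_le_iff₀ hh] at h4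
          exact (one_le_div hs).2 h4
  · have hJ : σ ^ 2 + (jamming σ ν a h : ℝ) = a * (ν * h / (1 + ν * h)) := by
      rw [jamming, Real.coe_toNNReal _ h1]
      ring
    have h2 : σ ^ 2 * (1 + ν * h) ≤ a * ν * h := by
      rw [sub_nonneg, ← mul_div_assoc, le_div_iff₀ ht] at h1
      linarith
    have h3 : 1 + ν * h ≤ a * ν * h / σ ^ 2 := by
      rw [le_div_iff₀ hs]
      linarith
    have hW : (waterFilling σ (a * ν) (jamming σ ν a) h : ℝ) =
        ν * (σ ^ 2 + jamming σ ν a h) := by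
      have : a * ν - a * (ν * h / (1 + ν * h)) / h = ν * (a * (ν * h / (1 + ν * h))) := by
        field_simp
        ring
      rw [waterFilling, hJ, this, Real.coe_toNNReal _ (by positivity)]
    refine ⟨hW.le, Or.inr hW, ?_⟩
    have h4 : 0 < ν * h := by positivity
    rw [min_eq_right h3, max_eq_right (by linarith), hW, hJ]
    field_simp

theorem meanPower_jamming {p : ℝ → ℝ} [IsFiniteMeasure (channelLaw p)] {σ ν a : ℝ}
    (hσ : 0 < σ) (hν : 0 < ν) :
    meanPower p (jamming σ ν a) = ENNReal.ofReal (jamMean (channelLaw p) (σ ^ 2) ν a) := by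
  rw [jamMean, ofReal_integral_eq_lintegral_ofReal
    (integrable_jam (ae_pos_channelLaw p) a (by positivity) hν)
    (.of_forall fun h => le_max_right _ _)]
  refine lintegral_congr fun h => ?_
  rw [jamming, ← ENNReal.ofReal_coe_nnreal, Real.coe_toNNReal']

theorem ergodicCapacity_waterFilling_jamming {p : ℝ → ℝ} [IsFiniteMeasure (channelLaw p)]
    (hlog : Integrable (fun h : ℝ => Real.log (1 + h)) (channelLaw p)) {σ ν a : ℝ}
    (hσ : 0 < σ) (hν : 0 < ν) (ha : 0 < a) :
    ergodicCapacity p σ (waterFilling σ (a * ν) (jamming σ ν a)) (jamming σ ν a) =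
      ENNReal.ofReal (rateMean (channelLaw p) (σ ^ 2) ν a) := by
  rw [rateMean, ofReal_integral_eq_lintegral_ofReal
    (integrable_rate (ae_pos_channelLaw p) hlog a hν.le)
    (.of_forall fun h => Real.log_nonneg (le_max_left _ _))]
  refine lintegral_congr_ae ?_
  filter_upwards [ae_pos_channelLaw p] with h hh
  rw [(waterFilling_jamming hσ hν hh ha).2.2]

/-- At the saddle point's signal-to-noise ratio the transmitter pays at most `ν` per unit of
jamming, and exactly `ν` where the jammer is active; so no jammer with the same budget is more
expensive. -/
theorem meanPower_transfer_le {p : ℝ → ℝ} {σ ν a j : ℝ} (hσ : 0 < σ) (hν : 0 < ν) (ha : 0 < a)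
    (hj : meanPower p (jamming σ ν a) = ENNReal.ofReal j) {J : ℝ → ℝ≥0}
    (hJ : J ∈ jammerStrategies p j) :
    meanPower p (transfer σ (waterFilling σ (a * ν) (jamming σ ν a)) (jamming σ ν a) J) ≤
      meanPower p (waterFilling σ (a * ν) (jamming σ ν a)) := by
  have hJm := hJ.1
  have hKm := measurable_jamming σ ν a
  have hWm := measurable_waterFilling σ (a * ν) hKm
  have hTm := measurable_transfer σ hWm hKm hJm
  have key : meanPower p (transfer σ (waterFilling σ (a * ν) (jamming σ ν a)) (jamming σ ν a) J) +
      ENNReal.ofReal ν * meanPower p (jamming σ ν a) ≤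
      meanPower p (waterFilling σ (a * ν) (jamming σ ν a)) +
        ENNReal.ofReal ν * meanPower p J := by
    unfold meanPower
    rw [← lintegral_const_mul _ (by fun_prop), ← lintegral_const_mul _ (by fun_prop),
      ← lintegral_add_left (by fun_prop), ← lintegral_add_left (by fun_prop)]
    refine lintegral_mono_ae ?_
    filter_upwards [ae_pos_channelLaw p] with h hh
    obtain ⟨h1, h2, -⟩ := waterFilling_jamming hσ hν hh ha
    rw [ENNReal.ofReal]
    norm_cast
    rw [← NNReal.coe_le_coe]
    push_cast
    rw [coe_transfer, Real.coe_toNNReal _ hν.le]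
    have hN : 0 < σ ^ 2 + (jamming σ ν a h : ℝ) := by positivity
    generalize (waterFilling σ (a * ν) (jamming σ ν a) h : ℝ) = W at h1 h2
    have hJ0 : (0 : ℝ) ≤ J h := (J h).coe_nonneg
    rcases h2 with h2 | h2
    · rw [h2, NNReal.coe_zero, add_zero] at h1 hN ⊢
      rw [mul_zero, add_zero, div_le_iff₀ hN]
      nlinarith
    · rw [h2]
      refine le_of_eq ?_
      field_simp
      ring
  rw [hj] at key
  refine (ENNReal.add_le_add_iff_right (a := ENNReal.ofReal ν * ENNReal.ofReal j)
    (by finiteness)).1 (key.trans ?_)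
  gcongr
  exact hJ.2

theorem exists_isMaximinOptimal {p : ℝ → ℝ} [IsProbabilityMeasure (channelLaw p)]
    (hlog : Integrable (fun h : ℝ => Real.log (1 + h)) (channelLaw p)) {σ R j : ℝ}
    (hσ : 0 < σ) (hR : 0 < R) (hj : 0 ≤ j) :
    ∃ J P : ℝ → ℝ≥0, IsMaximinOptimal p σ R j J P ∧ meanPower p P < ⊤ := by
  have hs : 0 < σ ^ 2 := by positivity
  obtain ⟨ν, a, hν, hsa, hjam, hrate⟩ :=
    exists_parameters (ae_pos_channelLaw p) hlog hs hR hj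
  have ha : 0 < a := hs.trans_le hsa
  have hJm := measurable_jamming σ ν a
  have hJ : meanPower p (jamming σ ν a) = ENNReal.ofReal j := by
    rw [meanPower_jamming hσ hν, hjam]
  have hC := ergodicCapacity_waterFilling_jamming hlog hσ hν ha
  rw [hrate] at hC
  have hP : waterFilling σ (a * ν) (jamming σ ν a) ∈
      reliableStrategies p σ R (jamming σ ν a) :=
    ⟨measurable_waterFilling σ _ hJm, hC.ge⟩
  have hmin : meanPower p (waterFilling σ (a * ν) (jamming σ ν a)) =
      minTxPower p σ R (jamming σ ν a) :=
    le_antisymm (le_iInf₂ fun Q hQ => meanPower_waterFilling_le hσ (by positivity) hJm hC hQ)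
      (minTxPower_le hP)
  refine ⟨jamming σ ν a, _, ⟨⟨hJm, hJ.le⟩, hP, hmin, ?_⟩, ?_⟩
  · refine le_antisymm (minTxPower_le_requiredTxPower ⟨hJm, hJ.le⟩) (iSup₂_le fun J' hJ' => ?_)
    rw [← hmin]
    exact (minTxPower_le (transfer_mem hσ hJm hJ'.1 hP)).trans
      (meanPower_transfer_le hσ hν ha hJ hJ')
  · calc meanPower p (waterFilling σ (a * ν) (jamming σ ν a))
        ≤ ∫⁻ _, ENNReal.ofReal (a * ν) ∂channelLaw p := by
          refine lintegral_mono_ae ?_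
          filter_upwards [ae_pos_channelLaw p] with h hh
          exact ENNReal.coe_le_coe.2 (Real.toNNReal_le_toNNReal
            (sub_le_self _ (by positivity)))
      _ < ⊤ := by simp

/-! ### The value as a function of the jammer's power -/

theorem requiredTxPower_mono {p : ℝ → ℝ} {σ R j k : ℝ} (hjk : j ≤ k) :
    requiredTxPower p σ R j ≤ requiredTxPower p σ R k :=
  iSup₂_le fun _ hJ =>
    minTxPower_le_requiredTxPower ⟨hJ.1, hJ.2.trans (ENNReal.ofReal_le_ofReal hjk)⟩

theorem minTxPower_ne_zero_of_attained {p : ℝ → ℝ} {σ R : ℝ} (hR : 0 < R) {J P : ℝ → ℝ≥0}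
    (hP : P ∈ reliableStrategies p σ R J) (hmin : meanPower p P = minTxPower p σ R J) :
    minTxPower p σ R J ≠ 0 := by
  intro h0
  have hPm := hP.1
  rw [h0, meanPower, lintegral_eq_zero_iff (by fun_prop)] at hmin
  have : ergodicCapacity p σ P J = 0 := by
    rw [ergodicCapacity, ← lintegral_zero (μ := channelLaw p)]
    refine lintegral_congr_ae ?_
    filter_upwards [hmin] with h hh
    have : P h = 0 := by simpa using hh
    simp [this]
  have h1 := hP.2
  rw [this, nonpos_iff_eq_zero, ENNReal.ofReal_eq_zero] at h1
  exact h1.not_gt hR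

/-- Against the uniform jammer `J = j` all powers grow by the factor `1 + j / σ²` over `J = J₀`
with `J₀ = 0` almost everywhere. -/
theorem mul_minTxPower_le_requiredTxPower {p : ℝ → ℝ} [IsProbabilityMeasure (channelLaw p)]
    {σ R j : ℝ} (hσ : 0 < σ) {J₀ : ℝ → ℝ≥0} (hJ₀ : J₀ ∈ jammerStrategies p 0) (hj : 0 ≤ j) :
    ENNReal.ofReal (1 + j / σ ^ 2) * minTxPower p σ R J₀ ≤ requiredTxPower p σ R j := by
  have hJm := hJ₀.1
  have hae : ∀ᵐ h ∂channelLaw p, J₀ h = 0 := by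
    have := hJ₀.2
    rw [ENNReal.ofReal_zero, nonpos_iff_eq_zero, meanPower,
      lintegral_eq_zero_iff (by fun_prop)] at this
    filter_upwards [this] with h hh
    simpa using hh
  have hmem : (fun _ => j.toNNReal) ∈ jammerStrategies p j :=
    ⟨measurable_const, by simp [meanPower, ENNReal.ofReal]⟩
  refine le_trans ?_ (minTxPower_le_requiredTxPower hmem)
  refine le_iInf₂ fun P hP => ?_
  have hPm := hP.1
  have hT := transfer_mem (J' := J₀) hσ measurable_const hJm hP
  have hTm := hT.1
  refine (mul_le_mul_right (minTxPower_le hT) _).trans_eq ?_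
  unfold meanPower
  rw [← lintegral_const_mul _ (by fun_prop)]
  refine lintegral_congr_ae ?_
  filter_upwards [hae] with h hh
  rw [ENNReal.ofReal]
  norm_cast
  refine NNReal.eq ?_
  push_cast
  rw [coe_transfer, hh, Real.coe_toNNReal _ (by positivity), Real.coe_toNNReal _ hj]
  have : σ ^ 2 + j ≠ 0 := by positivity
  simp only [NNReal.coe_zero]
  field_simp
  ring

/-- A monotone concave function on `[0, ∞)` that takes a value twice never exceeds it afterwards,
so an unbounded one is strictly monotone. -/
theorem strictMonoOn_of_concaveOn_of_not_bddAbove {f : ℝ → ℝ} (hm : MonotoneOn f (Set.Ici 0))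
    (hc : ConcaveOn ℝ (Set.Ici 0) f) (hb : ¬ BddAbove (f '' Set.Ici 0)) :
    StrictMonoOn f (Set.Ici 0) := by
  intro x hx y hy hxy
  refine (hm hx hy hxy.le).lt_of_ne fun heq => hb ⟨f y, ?_⟩
  rintro _ ⟨z, hz, rfl⟩
  rcases le_or_gt z y with hzy | hyz
  · exact hm hz hy hzy
  · have := hc.slope_anti_adjacent hx hz hxy hyz
    rw [heq, sub_self, zero_div, div_nonpos_iff] at this
    rcases this with h | h
    · linarith [h.2]
    · linarith [h.1]

end JammingGame

theorem mainTheorem6 (p : ℝ → ℝ) (hp : JammingGame.IsChannelPDF p)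
    (hcap : ∫⁻ h, ENNReal.ofReal (Real.log (1 + h)) ∂JammingGame.channelLaw p < ⊤)
    (σ R : ℝ) (hσ : 0 < σ) (hR : 0 < R) :
    (∀ j : ℝ, 0 ≤ j → ∃ J P : ℝ → ℝ≥0, JammingGame.IsMaximinOptimal p σ R j J P) ∧
    (∀ j : ℝ, 0 ≤ j → JammingGame.requiredTxPower p σ R j < ⊤) ∧
    StrictMonoOn (fun j : ℝ => (JammingGame.requiredTxPower p σ R j).toReal) (Set.Ici 0) ∧
    ¬ BddAbove ((fun j : ℝ => (JammingGame.requiredTxPower p σ R j).toReal) '' Set.Ici 0) ∧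
    ConcaveOn ℝ (Set.Ici 0)
      (fun j : ℝ => (JammingGame.requiredTxPower p σ R j).toReal) := by
  have := JammingGame.channelLaw_isProbabilityMeasure hp
  have hlog : Integrable (fun h : ℝ => Real.log (1 + h)) (JammingGame.channelLaw p) := by
    refine ⟨Measurable.aestronglyMeasurable (by fun_prop), ?_⟩
    rw [hasFiniteIntegral_iff_ofReal]
    · exact hcap
    · filter_upwards [JammingGame.ae_pos_channelLaw p] with h hh
      exact Real.log_nonneg (by linarith)
  have hex := fun (j : ℝ) (hj : 0 ≤ j) =>
    JammingGame.exists_isMaximinOptimal hlog hσ hR hj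
  have hfin : ∀ j : ℝ, 0 ≤ j → JammingGame.requiredTxPower p σ R j < ⊤ := fun j hj => by
    obtain ⟨J, P, h, hP⟩ := hex j hj
    rwa [← h.jammer_optimal, ← h.tx_optimal]
  have hmono : MonotoneOn (fun j : ℝ => (JammingGame.requiredTxPower p σ R j).toReal)
      (Set.Ici 0) := fun x _ y hy hxy =>
    ENNReal.toReal_mono (hfin y hy).ne (JammingGame.requiredTxPower_mono hxy)
  have hconc : ConcaveOn ℝ (Set.Ici 0)
      (fun j : ℝ => (JammingGame.requiredTxPower p σ R j).toReal) := by
    refine ⟨convex_Ici 0, fun x hx y hy b c hb hc hbc => ?_⟩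
    have hx' : 0 ≤ x := hx
    have hy' : 0 ≤ y := hy
    lift b to ℝ≥0 using hb
    lift c to ℝ≥0 using hc
    obtain ⟨J₁, P₁, h₁, -⟩ := hex x hx
    obtain ⟨J₂, P₂, h₂, -⟩ := hex y hy
    have m₁ := h₁.jammer_mem.1
    have m₂ := h₂.jammer_mem.1
    have hmem : (fun h => b * J₁ h + c * J₂ h) ∈
        JammingGame.jammerStrategies p ((b : ℝ) * x + c * y) := by
      refine ⟨by fun_prop, ?_⟩
      rw [ENNReal.ofReal_add (by positivity) (by positivity), ENNReal.ofReal_mul b.coe_nonneg,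
        ENNReal.ofReal_mul c.coe_nonneg, ENNReal.ofReal_coe_nnreal, ENNReal.ofReal_coe_nnreal]
      refine le_trans (le_of_eq ?_) (add_le_add (mul_le_mul_right h₁.jammer_mem.2 (b : ℝ≥0∞))
        (mul_le_mul_right h₂.jammer_mem.2 (c : ℝ≥0∞)))
      unfold JammingGame.meanPower
      rw [← lintegral_const_mul _ (by fun_prop), ← lintegral_const_mul _ (by fun_prop),
        ← lintegral_add_left (by fun_prop)]
      push_cast
      rfl
    have key := (JammingGame.minTxPower_concave (p := p) (R := R) hσ m₁ m₂
      (x := b) (y := c) (by exact_mod_cast hbc)).trans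
      (JammingGame.minTxPower_le_requiredTxPower hmem)
    rw [h₁.jammer_optimal, h₂.jammer_optimal] at key
    have fx := (hfin x hx).ne
    have fy := (hfin y hy).ne
    have := ENNReal.toReal_mono (hfin ((b : ℝ) * x + c * y) (by positivity)).ne key
    rw [ENNReal.toReal_add (by finiteness) (by finiteness), ENNReal.toReal_mul,
      ENNReal.toReal_mul] at this
    exact this
  have hunb : ¬ BddAbove ((fun j : ℝ => (JammingGame.requiredTxPower p σ R j).toReal) ''
      Set.Ici 0) := by
    rintro ⟨B, hB⟩
    obtain ⟨J, P, h, hP⟩ := hex 0 le_rfl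
    set v := (JammingGame.minTxPower p σ R J).toReal with hv
    have hv0 : 0 < v := ENNReal.toReal_pos
      (JammingGame.minTxPower_ne_zero_of_attained hR h.tx_mem h.tx_optimal)
      (h.tx_optimal ▸ hP.ne)
    have hle : ∀ j : ℝ, 0 ≤ j → (1 + j / σ ^ 2) * v ≤ B := fun j hj => by
      have := ENNReal.toReal_mono (hfin j hj).ne
        (JammingGame.mul_minTxPower_le_requiredTxPower (R := R) hσ h.jammer_mem hj)
      rw [ENNReal.toReal_mul, ENNReal.toReal_ofReal (by positivity)] at this
      exact this.trans (hB ⟨j, hj, rfl⟩)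
    have h1 := hle (σ ^ 2 * (|B| / v)) (by positivity)
    rw [mul_div_cancel_left₀ _ (by positivity), add_mul, div_mul_cancel₀ _ hv0.ne'] at h1
    linarith [le_abs_self B]
  refine ⟨fun j hj => ?_, hfin,
    JammingGame.strictMonoOn_of_concaveOn_of_not_bddAbove hmono hconc hunb, hunb, hconc⟩
  obtain ⟨J, P, h, -⟩ := hex j hj
  exact ⟨J, P, h⟩
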